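/- All rings are commutative, associative and unital. For a ring $R$ let $R^*$ be its group of invertible elements and let $K_2^M(R)$ be the quotient of $R^*\otimes_{\mathbb Z}R^*$ by the subgroup generated by the elements $r\otimes(1-r)$ with $r,1-r\in R^*$; it is written additively, and the class of $r\otimes s$ is denoted by $\{r,s\}$. For an ideal $I\subset R$ put $K_2^M(R,I)=\mathrm{Ker}\big(K_2^M(R)\to K_2^M(R/I)\big)$. A ring $R$ is called weakly $5$-fold stable if for any $r_1,\dots,r_4\in R$ there is $r\in R^*$ such that $r_1+r,\dots,r_4+r\in R^*$. Let $S$ be a weakly $5$-fold stable ring in which $2$ is invertible. Put $U_0=S[[t]]^*$ and $U_p=1+t^pS[[t]]$ for $p\geqslant 1$. For $p\geqslant 0$ let $V_p\subset K_2^M(S[[t]])$ be the subgroup generated by the symbols $\{f,g\}$ with $f\in U_i$, $g\in U_j$, where $i,j\geqslant 0$ and $i+j\geqslant p$. Put $W_0=K_2^M(S[[t]])$ and $W_p=K_2^M\big(S[[t]],(t^p)\big)$ for $p\geqslant 1$. For $p=0$ the factor $p^{p-1}$ below is read as $1$. (1) For every $p\geqslant 0$ one has $p^{p-1}\cdot V_p\subset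 W_p$. In particular, if $p\geqslant 1$ is invertible in $S$, then $V_p=W_p$. (2) Let $i,j,p\geqslant 0$ be natural numbers with $i+j\geqslant p$, let $\bar t$ be the image of $t$ in $S[t]/(t^p)$, and let $a,b\in S$ be such that $1+a\bar t^{\,i}$ and $1+b\bar t^{\,j}$ are invertible in $S[t]/(t^p)$ (which is automatic when $i,j\geqslant 1$). Then $$p^{p-1}\cdot\{1+a\bar t^{\,i},1+b\bar t^{\,j}\}=0$$ in $K_2^M\big(S[t]/(t^p)\big)$. In particular, if $p\geqslant 1$ is invertible in $S$, then $\{1+a\bar t^{\,i},1+b\bar t^{\,j}\}=0$ in $K_2^M\big(S[t]/(t^p)\big)$. -/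

import Mathlib

open scoped TensorProduct

/-- A commutative ring `R` is weakly `k`-fold stable (`k ≥ 2`) if any `k - 1` elements of `R`
can be shifted by one and the same invertible element so that all of them become invertible. -/
def IsWeaklyStable (k : ℕ) (R : Type*) [CommRing R] : Prop :=
  ∀ r : Fin (k - 1) → R, ∃ u : Rˣ, ∀ i, IsUnit (r i + u)

namespace MilnorK

section General

variable (R : Type*) [CommRing R]

/-- The subgroup `St₂(R)` of `R* ⊗ R*` generated by the Steinberg relations `r ⊗ (1 - r)`
with `r` and `1 - r` invertible. -/
noncomputable def steinberg : AddSubgroup (Additive Rˣ ⊗[ℤ] Additive Rˣ) :=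
  AddSubgroup.closure
    {x | ∃ r s : Rˣ, (s : R) = 1 - (r : R) ∧ x = Additive.ofMul r ⊗ₜ[ℤ] Additive.ofMul s}

/-- The second Milnor K-group `K₂ᴹ(R) = (R* ⊗ R*) / St₂(R)`, written additively. -/
abbrev K₂ : Type _ := (Additive Rˣ ⊗[ℤ] Additive Rˣ) ⧸ steinberg R

variable {R}

/-- The symbol `{r, s}` in `K₂ᴹ(R)`. -/
noncomputable def symbol (r s : Rˣ) : K₂ R :=
  QuotientAddGroup.mk (Additive.ofMul r ⊗ₜ[ℤ] Additive.ofMul s)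

/-- The homomorphism `R* → R'*` induced by a ring homomorphism, written additively. -/
noncomputable def unitsMap {R' : Type*} [CommRing R'] (φ : R →+* R') : Additive Rˣ →ₗ[ℤ] Additive R'ˣ :=
  (MonoidHom.toAdditive (Units.map (φ : R →* R'))).toIntLinearMap

theorem steinberg_le_comap {R' : Type*} [CommRing R'] (φ : R →+* R') :
    steinberg R ≤ (steinberg R').comap
      (TensorProduct.map (unitsMap φ) (unitsMap φ)).toAddMonoidHom := by
  refine (AddSubgroup.closure_le _).2 ?_
  rintro _ ⟨r, s, h, rfl⟩
  refine AddSubgroup.subset_closure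
    ⟨Units.map (φ : R →* R') r, Units.map (φ : R →* R') s, ?_, rfl⟩
  simp [h]

/-- Functoriality: the homomorphism `K₂ᴹ(R) → K₂ᴹ(R')` induced by a ring homomorphism. -/
noncomputable def map {R' : Type*} [CommRing R'] (φ : R →+* R') : K₂ R →+ K₂ R' :=
  QuotientAddGroup.map (steinberg R) (steinberg R')
    (TensorProduct.map (unitsMap φ) (unitsMap φ)).toAddMonoidHom (steinberg_le_comap φ)

theorem map_symbol {R' : Type*} [CommRing R'] (φ : R →+* R') (r s : Rˣ) :
    map φ (symbol r s) = symbol (Units.map (φ : R →* R') r) (Units.map (φ : R →* R') s) :=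
  rfl

/-- The relative Milnor K-group `K₂ᴹ(R, I) = Ker (K₂ᴹ(R) → K₂ᴹ(R/I))`. -/
noncomputable def relK₂ (I : Ideal R) : AddSubgroup (K₂ R) :=
  (map (Ideal.Quotient.mk I)).ker

end General

section PowerSeriesFiltrations

variable (S : Type*) [CommRing S]

/-- The filtration on `S[[t]]*`: `U 0 = S[[t]]*` and `U p = 1 + t^p S[[t]]` for `p ≥ 1`. -/
def U : ℕ → Set (PowerSeries S)ˣ
  | 0 => Set.univ
  | p + 1 => {f | ∃ g : PowerSeries S, (f : PowerSeries S) = 1 + PowerSeries.X ^ (p + 1) * g}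

/-- `V p ⊆ K₂ᴹ(S[[t]])` is the subgroup generated by the symbols `{f, g}` with
`f ∈ U i`, `g ∈ U j`, `i + j ≥ p`. -/
noncomputable def V (p : ℕ) : AddSubgroup (K₂ (PowerSeries S)) :=
  AddSubgroup.closure
    {x | ∃ i j : ℕ, p ≤ i + j ∧ ∃ f ∈ U S i, ∃ g ∈ U S j, x = symbol f g}

/-- `W 0 = K₂ᴹ(S[[t]])` and `W p = K₂ᴹ(S[[t]], (t^p))` for `p ≥ 1`. -/
noncomputable def W : ℕ → AddSubgroup (K₂ (PowerSeries S))
  | 0 => ⊤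
  | p + 1 => relK₂ (Ideal.span {(PowerSeries.X : PowerSeries S) ^ (p + 1)})

end PowerSeriesFiltrations

section TruncatedPolynomials

variable (S : Type*) [CommRing S]

/-- The truncated polynomial ring `S[t]/(t^p)`. -/
abbrev Trunc (p : ℕ) : Type _ :=
  Polynomial S ⧸ Ideal.span {(Polynomial.X : Polynomial S) ^ p}

/-- The image `t̄` of `t` in `S[t]/(t^p)`. -/
noncomputable def tbar (p : ℕ) : Trunc S p :=
  Ideal.Quotient.mk _ Polynomial.X

theorem tbar_pow_self (p : ℕ) : tbar S p ^ p = 0 := by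
  rw [tbar, ← map_pow]
  exact Ideal.Quotient.eq_zero_iff_mem.2 (Ideal.subset_span rfl)

variable {S}

/-- `1 + a t̄^i` is invertible in `S[t]/(t^p)` as soon as `i ≥ 1` or `1 + a` is invertible. -/
theorem isUnit_one_add (p : ℕ) (a : S) (i : ℕ) (h : 1 ≤ i ∨ IsUnit (1 + a)) :
    IsUnit (1 + algebraMap S (Trunc S p) a * tbar S p ^ i) := by
  rcases Nat.eq_zero_or_pos i with hi | hi
  · subst hi
    have h1 : IsUnit (1 + a) := h.resolve_left (by omega)
    simpa using h1.map (algebraMap S (Trunc S p))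
  · have hn : IsNilpotent (algebraMap S (Trunc S p) a * tbar S p ^ i) := by
      refine ⟨p, ?_⟩
      rw [mul_pow, ← pow_mul, mul_comm i p, pow_mul, tbar_pow_self, zero_pow (by omega), mul_zero]
    exact hn.isUnit_one_add

end TruncatedPolynomials

end MilnorK

/-!
Both parts reduce to a statement about a ring `R` with `t ^ p = 0`, to be applied to
`R = S[[t]]/(t^p)` and `R = S[t]/(t^p)`, which inherit weak stability from `S`: if `i + j ≥ p`,
the symbol `{1 + t^i a, 1 + t^j b}` is killed by `p ^ (p - 1)`, and vanishes if `p` is invertible.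
When `i = 0` or `j = 0` one entry is `1`, so let `i, j ≥ 1`.

Let `F n ⊆ K₂ᴹ(R)` be generated by the symbols `{1 + t^i a, 1 + t^j b}` with `i, j ≥ 1` and
`i + j ≥ n` (`symbolFiltration`). Then `F (2p - 1) = 0`, so it is enough to show that `p` kills
`F n / F (n + 1)` for each `n ≥ p` (`nsmul_gradedSymbol`); there are `p - 1` steps from `F p` to
`F (2p - 1)`. If `p` is invertible, each of these quotients vanishes, because its generators can be
divided by `p`.

In `F n / F (n + 1)` the symbol `ψ i j a b = {1 + t^i a, 1 + t^j b}`, `i + j = n`, is biadditive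
and antisymmetric. More relations come from the Steinberg relation for `u (1 + x)` and
`v (1 - c x)`, where `u + v = 1` and `c = u / v`. Its second cross effect for `x = t^i a` and
`y = t^j b`, which satisfy `x y = 0`, is `{1 + x, 1 - c y} + {1 + y, 1 - c x} = 0`
(`symbol_cross_two`); this gives `ψ i j (a c) b = ψ i j a (c b)`, first for units `c` with `1 + c`
a unit and then for all `c`, since by stability they are sums of such units
(`gradedSymbol_mul_comm`). So `ψ i j a b` depends only on the product `a b`. The third cross effect
for `x y z = 0` (`symbol_cross_three`), with `u = v = 1/2`, gives
`ψ i (j + k) a 1 + ψ j (i + k) a 1 + ψ k (i + j) a 1 = 0` (`gradedSymbol_cyclic_of_two`).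
With antisymmetry this means that `T l = ψ l (n - l) a 1` is additive in `l`, so `T l = l • T 1`.
If `n > p` then `p • T 1 = T p = 0` because `t ^ p = 0`; if `n = p` then
`(p - 1) • T 1 = T (p - 1) = -T 1`. In both cases `p • T 1 = 0`.

The inclusion `W p ≤ V p` holds for any `S` (`W_le_V`), as units and Steinberg relations lift along
`S[[t]] → S[[t]]/(t^p)` for `p ≥ 1` (`relK₂_le`).
-/

namespace MilnorK

/-! ### Symbols and cross effects of the Steinberg relation -/

section Symbols

variable {R : Type*} [CommRing R]

theorem symbol_mul_left (r r' s : Rˣ) : symbol (r * r') s = symbol r s + symbol r' s := by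
  simp only [symbol, ofMul_mul, TensorProduct.add_tmul]
  rfl

theorem symbol_mul_right (r s s' : Rˣ) : symbol r (s * s') = symbol r s + symbol r s' := by
  simp only [symbol, ofMul_mul, TensorProduct.tmul_add]
  rfl

theorem symbol_one_left (s : Rˣ) : symbol (1 : Rˣ) s = 0 := by
  simp [symbol]

theorem symbol_one_right (r : Rˣ) : symbol r (1 : Rˣ) = 0 := by
  simp [symbol]

theorem symbol_inv_left (r s : Rˣ) : symbol r⁻¹ s = -symbol r s := by
  rw [eq_neg_iff_add_eq_zero, ← symbol_mul_left, inv_mul_cancel, symbol_one_left]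

theorem symbol_inv_right (r s : Rˣ) : symbol r s⁻¹ = -symbol r s := by
  rw [eq_neg_iff_add_eq_zero, ← symbol_mul_right, inv_mul_cancel, symbol_one_right]

theorem symbol_eq_zero_of_add_eq_one {r s : Rˣ} (h : (r : R) + s = 1) : symbol r s = 0 :=
  (QuotientAddGroup.eq_zero_iff _).2
    (AddSubgroup.subset_closure ⟨r, s, by rw [← h]; ring, rfl⟩)

/-- The relation `{r, -r} = 0` is established only for `1 - r` invertible, which suffices below. -/
theorem symbol_neg_self {r : Rˣ} (h : IsUnit (1 - (r : R))) : symbol r (-r) = 0 := by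
  obtain ⟨s, hs⟩ := h
  -- `-r = (1 - r) / (1 - r⁻¹)`
  have h1 : symbol r s = 0 := symbol_eq_zero_of_add_eq_one (by rw [hs]; ring)
  have h2 : symbol r⁻¹ (-r⁻¹ * s) = 0 := symbol_eq_zero_of_add_eq_one (by
    rw [Units.val_mul, hs, Units.val_neg]
    linear_combination (Units.inv_mul r))
  have h3 : -r = s * (-r⁻¹ * s)⁻¹ := by
    rw [mul_inv_rev, mul_inv_cancel_left]
    ext; simp
  rw [h3, symbol_mul_right, h1, symbol_inv_right, zero_add, ← symbol_inv_left, h2]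

theorem symbol_add_symbol_swap_of_isUnit {r s : Rˣ} (hr : IsUnit (1 - (r : R)))
    (hs : IsUnit (1 - (s : R))) (hrs : IsUnit (1 - (r * s : R))) :
    symbol r s + symbol s r = 0 := by
  have h : symbol (r * s) (-(r * s)) = 0 := symbol_neg_self (by simpa using hrs)
  have h1 : symbol r (-(r * s)) = symbol r (-r) + symbol r s := by
    rw [← symbol_mul_right, neg_mul]
  have h2 : symbol s (-(r * s)) = symbol s (-s) + symbol s r := by
    rw [← symbol_mul_right, neg_mul, mul_comm]
  rw [symbol_mul_left, h1, h2, symbol_neg_self hr, symbol_neg_self hs] at h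
  simpa using h

/-- The Steinberg relation for `u * f` and `v * g`, when `u` and `v` satisfy it themselves. -/
theorem symbol_perturbed_steinberg {u v f g : Rˣ} (huv : (u : R) + v = 1)
    (h : (u * f + v * g : R) = 1) : symbol u g + symbol f v + symbol f g = 0 := by
  have h1 : symbol (u * f) (v * g) = 0 := symbol_eq_zero_of_add_eq_one (by simpa using h)
  rw [symbol_mul_left, symbol_mul_right, symbol_mul_right, symbol_eq_zero_of_add_eq_one huv] at h1
  rw [← h1]; abel

/-- The second cross effect of `symbol_perturbed_steinberg`: the relation for the products
`f₁ * f₂`, `g₁ * g₂` minus those for the factors. -/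
theorem symbol_cross_two {u v f₁ f₂ g₁ g₂ : Rˣ} (huv : (u : R) + v = 1)
    (h₁ : (u * f₁ + v * g₁ : R) = 1) (h₂ : (u * f₂ + v * g₂ : R) = 1)
    (h₁₂ : (u * (f₁ * f₂) + v * (g₁ * g₂) : R) = 1) :
    symbol f₁ g₂ + symbol f₂ g₁ = 0 := by
  have e₁ := symbol_perturbed_steinberg huv h₁
  have e₂ := symbol_perturbed_steinberg huv h₂
  have e := symbol_perturbed_steinberg (f := f₁ * f₂) (g := g₁ * g₂) huv (by simpa using h₁₂)
  simp only [symbol_mul_left, symbol_mul_right] at e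
  linear_combination (norm := abel) e - e₁ - e₂

/-- The third cross effect of `symbol_perturbed_steinberg`. The units `d` correct the failure of the
second entry to be multiplicative in pairs, and no further correction is needed for the triple. -/
theorem symbol_cross_three {u v f₁ f₂ f₃ g₁ g₂ g₃ d₁₂ d₁₃ d₂₃ : Rˣ} (huv : (u : R) + v = 1)
    (h₁ : (u * f₁ + v * g₁ : R) = 1) (h₂ : (u * f₂ + v * g₂ : R) = 1)
    (h₃ : (u * f₃ + v * g₃ : R) = 1)
    (h₁₂ : (u * (f₁ * f₂) + v * (g₁ * g₂ * d₁₂) : R) = 1)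
    (h₁₃ : (u * (f₁ * f₃) + v * (g₁ * g₃ * d₁₃) : R) = 1)
    (h₂₃ : (u * (f₂ * f₃) + v * (g₂ * g₃ * d₂₃) : R) = 1)
    (h₁₂₃ : (u * (f₁ * f₂ * f₃) + v * (g₁ * g₂ * g₃ * d₁₂ * d₁₃ * d₂₃) : R) = 1) :
    symbol f₁ d₂₃ + symbol f₂ d₁₃ + symbol f₃ d₁₂ = 0 := by
  have e₁ := symbol_perturbed_steinberg huv h₁
  have e₂ := symbol_perturbed_steinberg huv h₂
  have e₃ := symbol_perturbed_steinberg huv h₃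
  have e₁₂ := symbol_perturbed_steinberg (f := f₁ * f₂) (g := g₁ * g₂ * d₁₂) huv
    (by simpa using h₁₂)
  have e₁₃ := symbol_perturbed_steinberg (f := f₁ * f₃) (g := g₁ * g₃ * d₁₃) huv
    (by simpa using h₁₃)
  have e₂₃ := symbol_perturbed_steinberg (f := f₂ * f₃) (g := g₂ * g₃ * d₂₃) huv
    (by simpa using h₂₃)
  have e := symbol_perturbed_steinberg (f := f₁ * f₂ * f₃)
    (g := g₁ * g₂ * g₃ * d₁₂ * d₁₃ * d₂₃) huv (by simpa using h₁₂₃)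
  simp only [symbol_mul_left, symbol_mul_right] at e e₁₂ e₁₃ e₂₃
  linear_combination (norm := abel) e - e₁₂ - e₁₃ - e₂₃ + e₁ + e₂ + e₃

open Classical in
/-- The element `1 + x` as a unit; the junk value is `1` when `1 + x` is not invertible. -/
noncomputable def oneAdd (x : R) : Rˣ :=
  if h : IsUnit (1 + x) then h.unit else 1

theorem coe_oneAdd {x : R} (h : IsNilpotent x) : (oneAdd x : R) = 1 + x := by
  rw [oneAdd, dif_pos h.isUnit_one_add, IsUnit.unit_spec]

theorem oneAdd_zero : oneAdd (0 : R) = 1 := by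
  ext; rw [coe_oneAdd IsNilpotent.zero]; simp

theorem eq_oneAdd {f : Rˣ} {x : R} (h : (f : R) = 1 + x) : f = oneAdd x := by
  have hu : IsUnit (1 + x) := h ▸ f.isUnit
  ext; rw [oneAdd, dif_pos hu, IsUnit.unit_spec, h]

theorem isUnit_add_of_isNilpotent {a x : R} (ha : IsUnit a) (hx : IsNilpotent x) :
    IsUnit (a + x) :=
  hx.isUnit_add_left_of_commute ha (Commute.all _ _)

/-- Antisymmetry of symbols on `1 + nilradical`. Twisting both entries by a unit `u` with `1 ± u`
invertible makes the four symbols involved antisymmetric. -/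
theorem symbol_oneAdd_swap (hR : IsWeaklyStable 5 R) {x y : R} (hx : IsNilpotent x)
    (hy : IsNilpotent y) :
    symbol (oneAdd x) (oneAdd y) = -symbol (oneAdd y) (oneAdd x) := by
  obtain ⟨u, hu⟩ := hR ![-1, 1, 0, 0]
  have hm : IsUnit (1 - (u : R)) := by
    have h := (hu 0).neg
    simpa [sub_eq_add_neg, add_comm] using h
  have hp : IsUnit (1 + (u : R)) := by simpa using hu 1
  have key : ∀ {a b : R}, IsNilpotent a → IsNilpotent b →
      symbol (oneAdd a * u) (oneAdd b * u) + symbol (oneAdd b * u) (oneAdd a * u) = 0 := by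
    intro a b ha hb
    have hmul : ∀ {c d : R}, IsNilpotent c → IsNilpotent (d * c) := fun {c d} hc =>
      Commute.isNilpotent_mul_left (Commute.all _ _) hc
    have one : ∀ {c : R}, IsNilpotent c → IsUnit (1 - ((oneAdd c * u : Rˣ) : R)) := by
      intro c hc
      have := isUnit_add_of_isNilpotent hm (hmul (d := -(u : R)) hc)
      rw [Units.val_mul, coe_oneAdd hc]
      convert this using 1; ring
    refine symbol_add_symbol_swap_of_isUnit (one ha) (one hb) ?_
    have hab : IsNilpotent (a + b + a * b) :=
      Commute.isNilpotent_add (Commute.all _ _)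
        (Commute.isNilpotent_add (Commute.all _ _) ha hb) (hmul hb)
    have := isUnit_add_of_isNilpotent (hm.mul hp) (hmul (d := -(u * u : R)) hab)
    rw [Units.val_mul, Units.val_mul, coe_oneAdd ha, coe_oneAdd hb]
    convert this using 1; ring
  have e₁ := key hx hy
  have e₂ := key hx IsNilpotent.zero
  have e₃ := key IsNilpotent.zero hy
  have e₄ := key IsNilpotent.zero IsNilpotent.zero
  simp only [symbol_mul_left, symbol_mul_right, oneAdd_zero, symbol_one_left,
    symbol_one_right, zero_add] at e₁ e₂ e₃ e₄
  linear_combination (norm := abel) e₁ - e₂ - e₃ + e₄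

end Symbols

/-! ### The symbol filtration of a nilpotent element -/

section Nilpotent

variable {R : Type*} [CommRing R]

/-- The subgroup of `K₂ᴹ(R)` generated by the symbols `{1 + t^i a, 1 + t^j b}` with `i, j ≥ 1` and
`i + j ≥ n`. It is only used for nilpotent `t`, so that all these elements are invertible. -/
noncomputable def symbolFiltration (t : R) (n : ℕ) : AddSubgroup (K₂ R) :=
  AddSubgroup.closure {x | ∃ (i j : ℕ) (a b : R), 1 ≤ i ∧ 1 ≤ j ∧ n ≤ i + j ∧
    x = symbol (oneAdd (t ^ i * a)) (oneAdd (t ^ j * b))}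

/-- The class of `{1 + t^i a, 1 + t^j b}` modulo the step `n + 1` of the symbol filtration. -/
noncomputable def gradedSymbol (t : R) (n i j : ℕ) (a b : R) :
    K₂ R ⧸ symbolFiltration t (n + 1) :=
  QuotientAddGroup.mk' (symbolFiltration t (n + 1))
    (symbol (oneAdd (t ^ i * a)) (oneAdd (t ^ j * b)))

variable {t : R} {n i j : ℕ}

theorem isNilpotent_pow_mul (ht : IsNilpotent t) (hi : 1 ≤ i) (a : R) :
    IsNilpotent (t ^ i * a) :=
  Commute.isNilpotent_mul_right (Commute.all _ _) (ht.pow_of_pos (by omega))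

theorem gradedSymbol_eq_zero_of_lt (hi : 1 ≤ i) (hj : 1 ≤ j) (h : n < i + j) (a b : R) :
    gradedSymbol t n i j a b = 0 :=
  (QuotientAddGroup.eq_zero_iff _).2
    (AddSubgroup.subset_closure ⟨i, j, a, b, hi, hj, h, rfl⟩)

/-- `a ↦ 1 + t^i a` is multiplicative up to a factor in `1 + t^(2i) R`. -/
theorem exists_oneAdd_mul_oneAdd (ht : IsNilpotent t) (hi : 1 ≤ i) (a a' : R) :
    ∃ w, oneAdd (t ^ i * a) * oneAdd (t ^ i * a') =
      oneAdd (t ^ i * (a + a')) * oneAdd (t ^ (i + i) * w) := by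
  refine ⟨a * a' * ↑(oneAdd (t ^ i * (a + a')))⁻¹, ?_⟩
  ext
  have h := Units.mul_inv (oneAdd (t ^ i * (a + a')))
  simp only [Units.val_mul]
  rw [coe_oneAdd (isNilpotent_pow_mul ht hi a), coe_oneAdd (isNilpotent_pow_mul ht hi a'),
    coe_oneAdd (isNilpotent_pow_mul (i := i + i) ht (by omega) _), pow_add]
  have e := coe_oneAdd (isNilpotent_pow_mul ht hi (a + a'))
  linear_combination (-t ^ i * t ^ i * a * a') * h - e

theorem gradedSymbol_add_left (ht : IsNilpotent t) (hi : 1 ≤ i) (hj : 1 ≤ j) (h : n ≤ i + j)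
    (a a' b : R) :
    gradedSymbol t n i j (a + a') b = gradedSymbol t n i j a b + gradedSymbol t n i j a' b := by
  obtain ⟨w, hw⟩ := exists_oneAdd_mul_oneAdd ht hi a a'
  have h0 := gradedSymbol_eq_zero_of_lt (t := t) (n := n) (i := i + i) (by omega) hj (by omega) w b
  unfold gradedSymbol at h0 ⊢
  rw [← map_add, ← symbol_mul_left, hw, symbol_mul_left, map_add, h0, add_zero]

theorem gradedSymbol_add_right (ht : IsNilpotent t) (hi : 1 ≤ i) (hj : 1 ≤ j) (h : n ≤ i + j)
    (a b b' : R) :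
    gradedSymbol t n i j a (b + b') = gradedSymbol t n i j a b + gradedSymbol t n i j a b' := by
  obtain ⟨w, hw⟩ := exists_oneAdd_mul_oneAdd ht hj b b'
  have h0 := gradedSymbol_eq_zero_of_lt (t := t) (n := n) (j := j + j) hi (by omega) (by omega) a w
  unfold gradedSymbol at h0 ⊢
  rw [← map_add, ← symbol_mul_right, hw, symbol_mul_right, map_add, h0, add_zero]

theorem gradedSymbol_neg_left (ht : IsNilpotent t) (hi : 1 ≤ i) (hj : 1 ≤ j) (h : n ≤ i + j)
    (a b : R) : gradedSymbol t n i j (-a) b = -gradedSymbol t n i j a b :=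
  map_neg (AddMonoidHom.mk' (fun x => gradedSymbol t n i j x b)
    fun x y => gradedSymbol_add_left ht hi hj h x y b) a

theorem gradedSymbol_nsmul_left (ht : IsNilpotent t) (hi : 1 ≤ i) (hj : 1 ≤ j) (h : n ≤ i + j)
    (m : ℕ) (a b : R) : gradedSymbol t n i j (m • a) b = m • gradedSymbol t n i j a b :=
  map_nsmul (AddMonoidHom.mk' (fun x => gradedSymbol t n i j x b)
    fun x y => gradedSymbol_add_left ht hi hj h x y b) m a

theorem gradedSymbol_neg_right (ht : IsNilpotent t) (hi : 1 ≤ i) (hj : 1 ≤ j) (h : n ≤ i + j)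
    (a b : R) : gradedSymbol t n i j a (-b) = -gradedSymbol t n i j a b :=
  map_neg (AddMonoidHom.mk' (fun x => gradedSymbol t n i j a x)
    fun x y => gradedSymbol_add_right ht hi hj h a x y) b

/-- Modulo the next step of the filtration, only `b` modulo `t` matters. -/
theorem gradedSymbol_mul_inv_right (ht : IsNilpotent t) (hi : 1 ≤ i) (hj : 1 ≤ j)
    (h : n ≤ i + j) (a b r : R) (s : Rˣ) (hs : (s : R) = 1 + t * r) :
    gradedSymbol t n i j a (b * ↑s⁻¹) = gradedSymbol t n i j a b := by
  have h0 : gradedSymbol t n i j a (t * (r * b * ↑s⁻¹)) = 0 := by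
    have := gradedSymbol_eq_zero_of_lt (t := t) (n := n) (j := j + 1) hi (by omega) (by omega) a
      (r * b * ↑s⁻¹)
    rwa [gradedSymbol, pow_succ, mul_assoc (t ^ j)] at this
  have e : b = b * ↑s⁻¹ + t * (r * b * ↑s⁻¹) := by
    linear_combination (-b) * Units.mul_inv s + b * ↑s⁻¹ * hs
  conv_rhs => rw [e, gradedSymbol_add_right ht hi hj h, h0, add_zero]

theorem gradedSymbol_swap (hR : IsWeaklyStable 5 R) (ht : IsNilpotent t) (hi : 1 ≤ i)
    (hj : 1 ≤ j) (a b : R) :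
    gradedSymbol t n i j a b = -gradedSymbol t n j i b a := by
  unfold gradedSymbol
  rw [symbol_oneAdd_swap hR (isNilpotent_pow_mul ht hi a) (isNilpotent_pow_mul ht hj b), map_neg]

/-- By stability every element is a sum of two units `c` with `1 + c` a unit. -/
theorem exists_eq_add_of_isWeaklyStable (hR : IsWeaklyStable 5 R) (s : R) :
    ∃ c d : R, s = c + d ∧ IsUnit c ∧ IsUnit (1 + c) ∧ IsUnit d ∧ IsUnit (1 + d) := by
  obtain ⟨u, hu⟩ := hR ![1, -s, -s - 1, 0]
  refine ⟨u, s - u, by ring, u.isUnit, by simpa using hu 0, ?_, ?_⟩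
  · convert (hu 1).neg using 1; simp; ring
  · convert (hu 2).neg using 1; simp; ring

variable {p : ℕ}

theorem gradedSymbol_mul_comm_of_isUnit (hR : IsWeaklyStable 5 R) (ht : t ^ p = 0) (hi : 1 ≤ i)
    (hj : 1 ≤ j) (hp : p ≤ i + j) (hn : n ≤ i + j) {c : R} (hc : IsUnit c) (hc' : IsUnit (1 + c))
    (a b : R) : gradedSymbol t n i j (a * c) b = gradedSymbol t n i j a (c * b) := by
  have ht' : IsNilpotent t := ⟨p, ht⟩
  obtain ⟨c, rfl⟩ := hc
  obtain ⟨w, hw⟩ := hc'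
  -- `u = c / (1 + c)` and `v = 1 / (1 + c)` add up to `1`, and `u (1 + x) + v (1 - c x) = 1`
  have hv : (1 + c : R) * ↑w⁻¹ = 1 := by rw [← hw, Units.mul_inv]
  have huv : ((c * w⁻¹ : Rˣ) : R) + (w⁻¹ : Rˣ) = 1 := by
    rw [Units.val_mul]; linear_combination hv
  have hxy : t ^ i * t ^ j = 0 := by rw [← pow_add]; exact pow_eq_zero_of_le hp ht
  have na := isNilpotent_pow_mul ht' hi
  have nb := isNilpotent_pow_mul ht' hj
  have key := symbol_cross_two (f₁ := oneAdd (t ^ i * a)) (f₂ := oneAdd (t ^ j * b))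
    (g₁ := oneAdd (t ^ i * (-(a * c)))) (g₂ := oneAdd (t ^ j * (-(c * b)))) huv
    (by rw [coe_oneAdd (na _), coe_oneAdd (na _), Units.val_mul]; linear_combination hv)
    (by rw [coe_oneAdd (nb _), coe_oneAdd (nb _), Units.val_mul]; linear_combination hv)
    (by
      rw [coe_oneAdd (na _), coe_oneAdd (na _), coe_oneAdd (nb _), coe_oneAdd (nb _),
        Units.val_mul]
      linear_combination hv + (c * ↑w⁻¹ * a * b + ↑w⁻¹ * a * b * c ^ 2) * hxy)
  have key' : gradedSymbol t n i j a (-(c * b)) + gradedSymbol t n j i b (-(a * c)) = 0 := by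
    rw [gradedSymbol, gradedSymbol, ← map_add, key, map_zero]
  rw [gradedSymbol_swap hR ht' hj hi, gradedSymbol_neg_left ht' hi hj hn,
    gradedSymbol_neg_right ht' hi hj hn, neg_neg, neg_add_eq_zero] at key'
  exact key'.symm

theorem gradedSymbol_mul_comm (hR : IsWeaklyStable 5 R) (ht : t ^ p = 0) (hi : 1 ≤ i)
    (hj : 1 ≤ j) (hp : p ≤ i + j) (hn : n ≤ i + j) (a b c : R) :
    gradedSymbol t n i j (a * c) b = gradedSymbol t n i j a (c * b) := by
  have ht' : IsNilpotent t := ⟨p, ht⟩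
  obtain ⟨c, d, rfl, hc, hc', hd, hd'⟩ := exists_eq_add_of_isWeaklyStable hR c
  rw [mul_add, add_mul, gradedSymbol_add_left ht' hi hj hn, gradedSymbol_add_right ht' hi hj hn,
    gradedSymbol_mul_comm_of_isUnit hR ht hi hj hp hn hc hc',
    gradedSymbol_mul_comm_of_isUnit hR ht hi hj hp hn hd hd']

/-- The third cross effect, applied to `x = t^i e`, `y = t^j`, `z = t^k`, whose product vanishes. -/
theorem gradedSymbol_cyclic_of_two (hR : IsWeaklyStable 5 R) (h2 : IsUnit (2 : R))
    (ht : t ^ p = 0) {k : ℕ} (hi : 1 ≤ i) (hj : 1 ≤ j) (hk : 1 ≤ k) (hp : p ≤ i + j + k)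
    (hn : n ≤ i + j + k) (a : R) :
    gradedSymbol t n i (j + k) a 1 + gradedSymbol t n j (i + k) a 1 +
      gradedSymbol t n k (i + j) a 1 = 0 := by
  have ht' : IsNilpotent t := ⟨p, ht⟩
  obtain ⟨w, hw⟩ := h2
  have hw1 : (2 : R) * ↑w⁻¹ = 1 := by rw [← hw, Units.mul_inv]
  have huv : ((w⁻¹ : Rˣ) : R) + (w⁻¹ : Rˣ) = 1 := by linear_combination hw1
  -- with `u = v = 1/2` the units `d` below have leading coefficient `-2`, and `-2 * e = a`
  set e : R := -(a * ↑w⁻¹) with he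
  have hxyz : t ^ i * t ^ j * t ^ k = 0 := by
    rw [← pow_add, ← pow_add]; exact pow_eq_zero_of_le hp ht
  have nil : ∀ {m : ℕ}, 1 ≤ m → ∀ b : R, IsNilpotent (t ^ m * b) :=
    fun hm b => isNilpotent_pow_mul ht' hm b
  have hg : ∀ {l m : ℕ}, 1 ≤ l → 1 ≤ m → ∀ x y : R,
      ∃ r, ((oneAdd (t ^ l * (-x)) * oneAdd (t ^ m * (-y)) : Rˣ) : R) = 1 + t * r := by
    intro l m hl hm x y
    obtain ⟨l, rfl⟩ := Nat.exists_eq_add_of_le' hl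
    obtain ⟨m, rfl⟩ := Nat.exists_eq_add_of_le' hm
    refine ⟨-t ^ l * x - t ^ m * y + t * t ^ l * t ^ m * x * y, ?_⟩
    rw [Units.val_mul, coe_oneAdd (nil hl _), coe_oneAdd (nil hm _)]
    ring
  have one : ∀ {m : ℕ}, 1 ≤ m → ∀ x : R,
      ((w⁻¹ : Rˣ) * oneAdd (t ^ m * x) + (w⁻¹ : Rˣ) * oneAdd (t ^ m * (-x)) : R) = 1 := by
    intro m hm x
    rw [coe_oneAdd (nil hm _), coe_oneAdd (nil hm _)]
    linear_combination hw1
  -- `d l m x y = 1 - 2 x' y' / ((1 - x') (1 - y'))` for `x' = t^l x`, `y' = t^m y`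
  let d : ℕ → ℕ → R → R → Rˣ := fun l m x y => oneAdd (t ^ (l + m) *
    (-2 * x * y * ↑(oneAdd (t ^ l * (-x)) * oneAdd (t ^ m * (-y)))⁻¹))
  have gd : ∀ {l m : ℕ}, 1 ≤ l → 1 ≤ m → ∀ x y : R,
      (oneAdd (t ^ l * (-x)) * oneAdd (t ^ m * (-y)) * d l m x y : R) =
        1 - t ^ l * x - t ^ m * y - t ^ l * t ^ m * x * y := by
    intro l m hl hm x y
    have hinv := Units.mul_inv (oneAdd (t ^ l * (-x)) * oneAdd (t ^ m * (-y)))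
    rw [Units.val_mul] at hinv
    simp only [d]
    rw [coe_oneAdd (nil (m := l + m) (by omega) _), pow_add, mul_add, mul_one]
    have hl' := coe_oneAdd (nil hl (-x))
    have hm' := coe_oneAdd (nil hm (-y))
    rw [← Units.val_mul] at hinv ⊢
    have hlm : ((oneAdd (t ^ l * (-x)) * oneAdd (t ^ m * (-y)) : Rˣ) : R) =
      (1 + t ^ l * (-x)) * (1 + t ^ m * (-y)) := by rw [Units.val_mul, hl', hm']
    linear_combination (-2 * t ^ l * t ^ m * x * y) * hinv + hlm
  have two : ∀ {l m : ℕ}, 1 ≤ l → 1 ≤ m → ∀ x y : R,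
      ((w⁻¹ : Rˣ) * (oneAdd (t ^ l * x) * oneAdd (t ^ m * y)) + (w⁻¹ : Rˣ) *
        (oneAdd (t ^ l * (-x)) * oneAdd (t ^ m * (-y)) * d l m x y) : R) = 1 := by
    intro l m hl hm x y
    rw [gd hl hm, coe_oneAdd (nil hl _), coe_oneAdd (nil hm _)]
    linear_combination hw1
  have key := symbol_cross_three huv (one hi e) (one hj 1) (one hk 1) (two hi hj e 1)
    (two hi hk e 1) (two hj hk 1 1) (by
      have h₁₂ := gd hi hj e 1
      have h₁₃ := gd hi hk e 1
      have h₂₃ := gd hj hk 1 1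
      refine (oneAdd (t ^ i * (-e)) * oneAdd (t ^ j * (-1)) *
        oneAdd (t ^ k * (-1))).isUnit.mul_left_cancel ?_
      simp only [Units.val_mul]
      rw [coe_oneAdd (nil hi _), coe_oneAdd (nil hj _)] at h₁₂
      rw [coe_oneAdd (nil hi _), coe_oneAdd (nil hk _)] at h₁₃
      rw [coe_oneAdd (nil hj _), coe_oneAdd (nil hk _)] at h₂₃
      rw [coe_oneAdd (nil hi _), coe_oneAdd (nil hj _), coe_oneAdd (nil hk _),
        coe_oneAdd (nil hi _), coe_oneAdd (nil hj _), coe_oneAdd (nil hk _)]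
      generalize (d i j e 1 : R) = d₁₂ at *
      generalize (d i k e 1 : R) = d₁₃ at *
      generalize (d j k 1 1 : R) = d₂₃ at *
      generalize t ^ i = x at *
      generalize t ^ j = y at *
      generalize t ^ k = z at *
      -- after multiplication by `(1 - x e) (1 - y) (1 - z)` both sides agree up to a multiple of
      -- `x y z = 0`; the last line is the cofactor
      linear_combination
        ↑w⁻¹ * ((1 - x * e) * (1 - z) * d₁₃ * ((1 - y) * (1 - z) * d₂₃)) * h₁₂ +
        ↑w⁻¹ * (1 - x * e - y - x * e * y) * ((1 - y) * (1 - z) * d₂₃) * h₁₃ +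
        ↑w⁻¹ * (1 - x * e - y - x * e * y) * (1 - x * e - z - x * e * z) * h₂₃ +
        (1 - x * e) * (1 - y) * (1 - z) * hw1 +
        ↑w⁻¹ * e * (6 - 2 * (x * e) - 2 * y - 2 * z - 2 * (x * e) * y - 2 * (x * e) * z
          - 2 * y * z - 2 * (x * e) * y * z) * hxyz)
  have key' : gradedSymbol t n i (j + k) e (-2 * 1 * 1) + gradedSymbol t n j (i + k) 1 (-2 * e * 1)
      + gradedSymbol t n k (i + j) 1 (-2 * e * 1) = 0 := by
    obtain ⟨r₁, h₁⟩ := hg hj hk 1 1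
    obtain ⟨r₂, h₂⟩ := hg hi hk e 1
    obtain ⟨r₃, h₃⟩ := hg hi hj e 1
    rw [← gradedSymbol_mul_inv_right ht' hi (by omega) (by omega) e (-2 * 1 * 1) r₁ _ h₁,
      ← gradedSymbol_mul_inv_right ht' hj (by omega) (by omega) 1 (-2 * e * 1) r₂ _ h₂,
      ← gradedSymbol_mul_inv_right ht' hk (by omega) (by omega) 1 (-2 * e * 1) r₃ _ h₃]
    simp only [gradedSymbol]
    rw [← map_add, ← map_add, key, map_zero]
  have bal : ∀ {l m : ℕ}, 1 ≤ l → 1 ≤ m → l + m = i + j + k → ∀ x y : R, x * y = a →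
      gradedSymbol t n l m x y = gradedSymbol t n l m a 1 := by
    intro l m hl hm hlm x y hxy
    rw [← hxy, gradedSymbol_mul_comm hR ht hl hm (by omega) (by omega), mul_one]
  have hea : -2 * e = a := by rw [he]; linear_combination a * hw1
  rwa [bal hi (by omega) (by omega) _ _ (by linear_combination hea),
    bal hj (by omega) (by omega) _ _ (by linear_combination hea),
    bal hk (by omega) (by omega) _ _ (by linear_combination hea)] at key'

theorem gradedSymbol_one_swap (hR : IsWeaklyStable 5 R) (ht : t ^ p = 0) (hi : 1 ≤ i)
    (hj : 1 ≤ j) (hp : p ≤ i + j) (hn : n ≤ i + j) (a : R) :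
    gradedSymbol t n i j a 1 = -gradedSymbol t n j i a 1 := by
  have h := gradedSymbol_mul_comm hR ht hj hi (by omega) (by omega) 1 1 a (n := n)
  rw [one_mul, mul_one] at h
  rw [gradedSymbol_swap hR ⟨p, ht⟩ hi hj, h]

/-- Each step of the filtration is killed by `p`: the classes `T l` of `{1 + t^l a, 1 + t^(n-l)}`
satisfy `T l = l • T 1`, and moreover `T p = 0` if `p < n` and `T (p - 1) = -T 1` if `p = n`. -/
theorem nsmul_gradedSymbol (hR : IsWeaklyStable 5 R) (h2 : IsUnit (2 : R)) (ht : t ^ p = 0)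
    (hi : 1 ≤ i) (hj : 1 ≤ j) (hp : p ≤ n) (hn : n = i + j) (a b : R) :
    p • gradedSymbol t n i j a b = 0 := by
  have mul : ∀ l, 1 ≤ l → l < n →
      gradedSymbol t n l (n - l) (a * b) 1 = l • gradedSymbol t n 1 (n - 1) (a * b) 1 := by
    intro l hl
    induction l, hl using Nat.le_induction with
    | base => intro _; rw [one_nsmul]
    | succ l hl ih =>
      intro hln
      have h := gradedSymbol_cyclic_of_two (n := n) (i := l) (j := 1) (k := n - (l + 1)) hR h2 ht hl
        le_rfl (by omega) (by omega) (by omega) (a * b)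
      rw [show 1 + (n - (l + 1)) = n - l by omega, show l + (n - (l + 1)) = n - 1 by omega,
        ih (by omega), gradedSymbol_one_swap (i := n - (l + 1)) hR ht (by omega) (by omega)
          (by omega) (by omega), ← succ_nsmul, ← sub_eq_add_neg, sub_eq_zero] at h
      exact h.symm
  have hT : p • gradedSymbol t n 1 (n - 1) (a * b) 1 = 0 := by
    rcases Nat.eq_zero_or_pos p with rfl | hp0
    · exact zero_nsmul _
    rcases hp.lt_or_eq with hlt | rfl
    · rw [← mul p hp0 hlt, gradedSymbol, ht, zero_mul, oneAdd_zero, symbol_one_left, map_zero]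
    · have h := mul (p - 1) (by omega) (by omega)
      rw [show p - (p - 1) = 1 by omega, gradedSymbol_one_swap hR ht (by omega) (by omega)
        (by omega) (by omega), neg_eq_iff_add_eq_zero, ← succ_nsmul',
        show p - 1 + 1 = p by omega] at h
      exact h
  have hb := gradedSymbol_mul_comm hR ht hi hj (by omega) (by omega) a 1 b (n := n)
  rw [mul_one] at hb
  rw [← hb, show j = n - i by omega, mul i hi (by omega), nsmul_left_comm, hT, nsmul_zero]

theorem symbolFiltration_le {H : AddSubgroup (K₂ R)}
    (h : ∀ (i j : ℕ) (a b : R), 1 ≤ i → 1 ≤ j → n ≤ i + j →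
      symbol (oneAdd (t ^ i * a)) (oneAdd (t ^ j * b)) ∈ H) : symbolFiltration t n ≤ H := by
  refine (AddSubgroup.closure_le _).2 ?_
  rintro _ ⟨i, j, a, b, hi, hj, hij, rfl⟩
  exact h i j a b hi hj hij

theorem symbol_mem_symbolFiltration (hi : 1 ≤ i) (hj : 1 ≤ j) (h : n ≤ i + j) (a b : R) :
    symbol (oneAdd (t ^ i * a)) (oneAdd (t ^ j * b)) ∈ symbolFiltration t n :=
  AddSubgroup.subset_closure ⟨i, j, a, b, hi, hj, h, rfl⟩

theorem nsmul_mem_symbolFiltration_succ (hR : IsWeaklyStable 5 R) (h2 : IsUnit (2 : R))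
    (ht : t ^ p = 0) (hp : p ≤ n) {x : K₂ R} (hx : x ∈ symbolFiltration t n) :
    p • x ∈ symbolFiltration t (n + 1) := by
  have h : symbolFiltration t n ≤
      (symbolFiltration t (n + 1)).comap (nsmulAddMonoidHom (α := K₂ R) p) := by
    refine symbolFiltration_le fun i j a b hi hj hij => ?_
    rw [AddSubgroup.mem_comap, nsmulAddMonoidHom_apply]
    rcases hij.lt_or_eq with hlt | heq
    · exact AddSubgroup.nsmul_mem _ (symbol_mem_symbolFiltration hi hj hlt a b) p
    · refine (QuotientAddGroup.eq_zero_iff _).1 ?_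
      exact nsmul_gradedSymbol hR h2 ht hi hj hp heq a b
  exact h hx

theorem symbolFiltration_le_succ (hR : IsWeaklyStable 5 R) (h2 : IsUnit (2 : R))
    (ht : t ^ p = 0) (hp : p ≤ n) (hu : IsUnit (p : R)) :
    symbolFiltration t n ≤ symbolFiltration t (n + 1) := by
  refine symbolFiltration_le fun i j a b hi hj hij => ?_
  rcases hij.lt_or_eq with hlt | heq
  · exact symbol_mem_symbolFiltration hi hj hlt a b
  · obtain ⟨q, hq⟩ := hu
    refine (QuotientAddGroup.eq_zero_iff _).1 ?_
    -- the pairing is additive in its first argument, and `a = p • (a / p)`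
    have ha : a = p • (↑q⁻¹ * a) := by
      rw [nsmul_eq_mul, ← hq, Units.mul_inv_cancel_left]
    have h := nsmul_gradedSymbol hR h2 ht hi hj hp heq (↑q⁻¹ * a) b
    rwa [← gradedSymbol_nsmul_left ⟨p, ht⟩ hi hj heq.le, ← ha] at h

/-- If `i + j ≥ 2p - 1` then `i ≥ p` or `j ≥ p`. -/
theorem symbolFiltration_eq_bot (ht : t ^ p = 0) (hn : 2 * p ≤ n + 1) :
    symbolFiltration t n = ⊥ := by
  refine le_bot_iff.1 (symbolFiltration_le fun i j a b _ _ hij => ?_)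
  rw [AddSubgroup.mem_bot]
  rcases le_or_gt p i with hi | hi
  · rw [pow_eq_zero_of_le hi ht, zero_mul, oneAdd_zero, symbol_one_left]
  · rw [pow_eq_zero_of_le (show p ≤ j by omega) ht, zero_mul, oneAdd_zero, symbol_one_right]

/-- The case of an arbitrary ring with `t ^ p = 0`, to which both parts of `mainTheorem3` reduce. -/
theorem pow_nsmul_symbol_eq_zero (hR : IsWeaklyStable 5 R) (h2 : IsUnit (2 : R))
    (ht : t ^ p = 0) (hp : p ≤ i + j) {f g : Rˣ} {a b : R} (hf : (f : R) = 1 + t ^ i * a)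
    (hg : (g : R) = 1 + t ^ j * b) :
    p ^ (p - 1) • symbol f g = 0 ∧ (IsUnit (p : R) → symbol f g = 0) := by
  rw [eq_oneAdd hf, eq_oneAdd hg]
  rcases Nat.eq_zero_or_pos i with rfl | hi
  · rw [pow_eq_zero_of_le (show p ≤ j by omega) ht, zero_mul, oneAdd_zero, symbol_one_right]
    simp
  rcases Nat.eq_zero_or_pos j with rfl | hj
  · rw [pow_eq_zero_of_le (show p ≤ i by omega) ht, zero_mul, oneAdd_zero, symbol_one_left]
    simp
  have hmem := symbol_mem_symbolFiltration (t := t) hi hj hp a b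
  constructor
  · -- `p - 1` steps lead from `p` to `2 * p - 1`, where the filtration vanishes
    have h : ∀ m, p ^ m • symbol (oneAdd (t ^ i * a)) (oneAdd (t ^ j * b)) ∈
        symbolFiltration t (p + m) := by
      intro m
      induction m with
      | zero => simpa using hmem
      | succ m ih =>
        rw [pow_succ', mul_nsmul']
        exact nsmul_mem_symbolFiltration_succ hR h2 ht (Nat.le_add_right p m) ih
    have h' := h (p - 1)
    rwa [symbolFiltration_eq_bot ht (by omega), AddSubgroup.mem_bot] at h'
  · intro hu
    have h : ∀ m, symbol (oneAdd (t ^ i * a)) (oneAdd (t ^ j * b)) ∈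
        symbolFiltration t (p + m) := by
      intro m
      induction m with
      | zero => exact hmem
      | succ m ih => exact symbolFiltration_le_succ hR h2 ht (Nat.le_add_right p m) hu ih
    have h' := h (p - 1)
    rwa [symbolFiltration_eq_bot ht (by omega), AddSubgroup.mem_bot] at h'

end Nilpotent

/-! ### Transfer of stability and generators of the relative group -/

section Relative

variable {R : Type*} [CommRing R]

theorem _root_.IsWeaklyStable.of_surjective {k : ℕ} {R' : Type*} [CommRing R']
    (h : IsWeaklyStable k R) (φ : R →+* R') (hφ : Function.Surjective φ) :
    IsWeaklyStable k R' := by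
  intro r
  choose s hs using fun i => hφ (r i)
  obtain ⟨u, hu⟩ := h s
  refine ⟨Units.map (φ : R →* R') u, fun i => ?_⟩
  have := (hu i).map φ
  rwa [map_add, hs] at this

theorem _root_.IsWeaklyStable.of_isLocalHom {k : ℕ} {R' : Type*} [CommRing R']
    (h : IsWeaklyStable k R') (φ : R →+* R') [IsLocalHom φ] (hφ : Function.Surjective φ) :
    IsWeaklyStable k R := by
  intro r
  obtain ⟨u, hu⟩ := h fun i => φ (r i)
  obtain ⟨v, hv⟩ := hφ u
  have hvu : IsUnit v := IsUnit.of_map φ v (hv ▸ u.isUnit)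
  refine ⟨hvu.unit, fun i => IsUnit.of_map φ _ ?_⟩
  rw [map_add, IsUnit.unit_spec, hv]
  exact hu i

/-- If units can be lifted along `R → R/I`, the relative group `K₂ᴹ(R, I)` is generated by symbols
with one entry in the kernel of `R* → (R/I)*`, because Steinberg relations can be lifted too. -/
theorem relK₂_le {I : Ideal R} [IsLocalHom (Ideal.Quotient.mk I)] {H : AddSubgroup (K₂ R)}
    (hl : ∀ f g : Rˣ, Units.map (Ideal.Quotient.mk I : R →* R ⧸ I) f = 1 → symbol f g ∈ H)
    (hr : ∀ f g : Rˣ, Units.map (Ideal.Quotient.mk I : R →* R ⧸ I) g = 1 → symbol f g ∈ H) :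
    relK₂ I ≤ H := by
  set φ := Ideal.Quotient.mk I
  have lift : ∀ u : (R ⧸ I)ˣ, ∃ v : Rˣ, Units.map (φ : R →* R ⧸ I) v = u := by
    intro u
    obtain ⟨v, hv⟩ := Ideal.Quotient.mk_surjective (u : R ⧸ I)
    have hvu : IsUnit v := IsUnit.of_map φ v (hv ▸ u.isUnit)
    exact ⟨hvu.unit, by ext; simpa using hv⟩
  have surj : Function.Surjective (unitsMap φ) := fun u => lift u.toMul
  set T := TensorProduct.map (unitsMap φ) (unitsMap φ)
  have hst : steinberg (R ⧸ I) ≤ (steinberg R).map T.toAddMonoidHom := by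
    refine (AddSubgroup.closure_le _).2 ?_
    rintro _ ⟨r, s, hrs, rfl⟩
    obtain ⟨r, rfl⟩ := lift r
    have hs : IsUnit (1 - (r : R)) := by
      refine IsUnit.of_map φ _ ?_
      rw [map_sub, map_one]
      exact ⟨s, by rw [hrs]; rfl⟩
    refine ⟨Additive.ofMul r ⊗ₜ Additive.ofMul hs.unit,
      AddSubgroup.subset_closure ⟨r, hs.unit, rfl, rfl⟩, ?_⟩
    have : s = Units.map (φ : R →* R ⧸ I) hs.unit := by
      ext; rw [hrs]; simp
    rw [this]; rfl
  have hker : ∀ x, T x = 0 → (QuotientAddGroup.mk x : K₂ R) ∈ H := by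
    intro x hx
    have ex := LinearMap.exact_subtype_ker_map (unitsMap φ)
    have hx' : x ∈ LinearMap.ker T := hx
    rw [TensorProduct.map_ker ex surj ex surj] at hx'
    let mk := (QuotientAddGroup.mk' (steinberg R)).toIntLinearMap
    let N : Submodule ℤ (Additive Rˣ ⊗[ℤ] Additive Rˣ) := H.toIntSubmodule.comap mk
    have hN : LinearMap.range
        ((LinearMap.ker (unitsMap φ)).subtype.lTensor (Additive Rˣ)) ⊔
        LinearMap.range ((LinearMap.ker (unitsMap φ)).subtype.rTensor (Additive Rˣ)) ≤ N := by
      refine sup_le ?_ ?_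
      · rintro _ ⟨z, rfl⟩
        induction z with
        | zero => rw [map_zero]; exact N.zero_mem
        | add z w hz hw => rw [map_add]; exact N.add_mem hz hw
        | tmul f g => exact hr f.toMul (Additive.toMul g.1) g.2
      · rintro _ ⟨z, rfl⟩
        induction z with
        | zero => rw [map_zero]; exact N.zero_mem
        | add z w hz hw => rw [map_add]; exact N.add_mem hz hw
        | tmul f g => exact hl (Additive.toMul f.1) g.toMul f.2
    exact hN hx'
  intro x hx
  obtain ⟨x, rfl⟩ := QuotientAddGroup.mk_surjective x
  have hx' : T x ∈ steinberg (R ⧸ I) := (QuotientAddGroup.eq_zero_iff _).1 hx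
  obtain ⟨y, hy, hyx⟩ := hst hx'
  have h := hker (x - y) (by rw [map_sub, sub_eq_zero]; exact hyx.symm)
  rwa [QuotientAddGroup.mk_sub, (QuotientAddGroup.eq_zero_iff y).2 hy, sub_zero] at h

end Relative

/-! ### Power series and truncated polynomials -/

section Application

variable {S : Type*} [CommRing S]

instance isLocalHom_powerSeries_constantCoeff :
    IsLocalHom (PowerSeries.constantCoeff : PowerSeries S →+* S) :=
  ⟨fun _ h => PowerSeries.isUnit_iff_constantCoeff.2 h⟩

/-- Whether a power series is a unit is seen on its constant coefficient, which factors through the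
quotient. -/
theorem isLocalHom_mk_span_X_pow (p : ℕ) : IsLocalHom (Ideal.Quotient.mk
    (Ideal.span {(PowerSeries.X : PowerSeries S) ^ (p + 1)})) := by
  refine ⟨fun f hf => ?_⟩
  have hle : ∀ a ∈ Ideal.span {(PowerSeries.X : PowerSeries S) ^ (p + 1)},
      (PowerSeries.constantCoeff : PowerSeries S →+* S) a = 0 := by
    intro a ha
    obtain ⟨b, rfl⟩ := Ideal.mem_span_singleton.1 ha
    simp
  have h := hf.map (Ideal.Quotient.lift _ _ hle)
  rw [Ideal.Quotient.lift_mk] at h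
  exact PowerSeries.isUnit_iff_constantCoeff.2 h

theorem exists_eq_one_add_of_mem_U {i : ℕ} {f : (PowerSeries S)ˣ} (hf : f ∈ U S i) :
    ∃ g : PowerSeries S, (f : PowerSeries S) = 1 + PowerSeries.X ^ i * g := by
  cases i with
  | zero => exact ⟨f - 1, by ring⟩
  | succ i => exact hf

theorem mem_U_of_map_eq_one {p : ℕ} {f : (PowerSeries S)ˣ}
    (hf : Units.map (Ideal.Quotient.mk (Ideal.span {(PowerSeries.X : PowerSeries S) ^ (p + 1)}) :
      PowerSeries S →* PowerSeries S ⧸ Ideal.span {(PowerSeries.X : PowerSeries S) ^ (p + 1)}) f =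
        1) : f ∈ U S (p + 1) := by
  have h := congrArg Units.val hf
  have h' : Ideal.Quotient.mk (Ideal.span {(PowerSeries.X : PowerSeries S) ^ (p + 1)})
      (f : PowerSeries S) = Ideal.Quotient.mk _ 1 := by
    rw [map_one]; exact h
  obtain ⟨g, hg⟩ := Ideal.mem_span_singleton.1 (Ideal.Quotient.eq.1 h')
  exact ⟨g, by rw [← hg]; ring⟩

theorem W_le_V (p : ℕ) : W S p ≤ V S p := by
  cases p with
  | zero =>
    intro x _
    obtain ⟨x, rfl⟩ := QuotientAddGroup.mk_surjective x
    induction x with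
    | zero => exact (V S 0).zero_mem
    | add x y hx hy =>
      exact (V S 0).add_mem (hx (AddSubgroup.mem_top _)) (hy (AddSubgroup.mem_top _))
    | tmul f g =>
      exact AddSubgroup.subset_closure
        ⟨0, 0, le_rfl, f.toMul, Set.mem_univ _, g.toMul, Set.mem_univ _, rfl⟩
  | succ p =>
    have := isLocalHom_mk_span_X_pow (S := S) p
    refine relK₂_le (fun f g hf => ?_) (fun f g hg => ?_)
    · exact AddSubgroup.subset_closure
        ⟨p + 1, 0, le_rfl, f, mem_U_of_map_eq_one hf, g, Set.mem_univ _, rfl⟩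
    · exact AddSubgroup.subset_closure
        ⟨0, p + 1, by omega, f, Set.mem_univ _, g, mem_U_of_map_eq_one hg, rfl⟩

theorem isWeaklyStable_powerSeries {k : ℕ} (hS : IsWeaklyStable k S) :
    IsWeaklyStable k (PowerSeries S) :=
  hS.of_isLocalHom PowerSeries.constantCoeff PowerSeries.constantCoeff_surj

/-- Evaluation at `0` is a surjective local homomorphism `S[t]/(t^p) → S` for `p ≥ 1`. -/
theorem isWeaklyStable_trunc {k : ℕ} (hS : IsWeaklyStable k S) (p : ℕ) :
    IsWeaklyStable k (Trunc S p) := by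
  rcases Nat.eq_zero_or_pos p with rfl | hp
  · have : Subsingleton (Trunc S 0) := subsingleton_of_zero_eq_one (by
      simpa using (tbar_pow_self S 0).symm)
    exact fun r => ⟨1, fun i => isUnit_of_subsingleton _⟩
  have hle : ∀ a ∈ Ideal.span {(Polynomial.X : Polynomial S) ^ p},
      (Polynomial.constantCoeff : Polynomial S →+* S) a = 0 := by
    intro a ha
    obtain ⟨b, rfl⟩ := Ideal.mem_span_singleton.1 ha
    rw [map_mul, map_pow, Polynomial.constantCoeff_apply, Polynomial.coeff_X_zero,
      zero_pow hp.ne', zero_mul]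
  let φ : Trunc S p →+* S := Ideal.Quotient.lift _ _ hle
  have hφ : ∀ f : Polynomial S, φ (Ideal.Quotient.mk _ f) = f.coeff 0 := fun f => by
    simp [φ]
  have : IsLocalHom φ := by
    refine ⟨fun x hx => ?_⟩
    obtain ⟨f, rfl⟩ := Ideal.Quotient.mk_surjective x
    rw [hφ] at hx
    have hn : IsNilpotent (tbar S p) := ⟨p, tbar_pow_self S p⟩
    rw [← Polynomial.X_mul_divX_add f, map_add, map_mul, add_comm]
    exact isUnit_add_of_isNilpotent
      (hx.map ((Ideal.Quotient.mk (Ideal.span {(Polynomial.X : Polynomial S) ^ p})).comp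
        Polynomial.C)) (Commute.isNilpotent_mul_right (Commute.all _ _) hn)
  exact hS.of_isLocalHom φ fun s => ⟨Ideal.Quotient.mk _ (Polynomial.C s), by simp [hφ]⟩

/-- Both cases of the inclusion `m • V p ⊆ W p`: `m = p ^ (p - 1)`, and `m = 1` for invertible
`p`. -/
theorem nsmul_mem_W_of_mem_V {p m : ℕ} (h2 : IsUnit (2 : S)) (hS : IsWeaklyStable 5 S)
    (hm : m = p ^ (p - 1) ∨ IsUnit (p : S) ∧ m = 1) {x : K₂ (PowerSeries S)} (hx : x ∈ V S p) :
    m • x ∈ W S p := by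
  cases p with
  | zero => exact AddSubgroup.mem_top _
  | succ p =>
    set I := Ideal.span {(PowerSeries.X : PowerSeries S) ^ (p + 1)} with hI
    set φ := Ideal.Quotient.mk I
    have hst : IsWeaklyStable 5 (PowerSeries S ⧸ I) :=
      (isWeaklyStable_powerSeries hS).of_surjective φ Ideal.Quotient.mk_surjective
    have unit : ∀ n : ℕ, IsUnit (n : S) → IsUnit (n : PowerSeries S ⧸ I) := fun n hn => by
      simpa using hn.map (φ.comp PowerSeries.C)
    have ht : φ PowerSeries.X ^ (p + 1) = 0 := by
      rw [← map_pow]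
      exact Ideal.Quotient.eq_zero_iff_mem.2 (Ideal.subset_span rfl)
    have hle : V S (p + 1) ≤
        (relK₂ I).comap (nsmulAddMonoidHom (α := K₂ (PowerSeries S)) m) := by
      refine (AddSubgroup.closure_le _).2 ?_
      rintro _ ⟨i, j, hij, f, hf, g, hg, rfl⟩
      obtain ⟨a, ha⟩ := exists_eq_one_add_of_mem_U hf
      obtain ⟨b, hb⟩ := exists_eq_one_add_of_mem_U hg
      have key := pow_nsmul_symbol_eq_zero hst (by exact_mod_cast unit 2 (by exact_mod_cast h2)) ht
        hij (f := Units.map (φ : PowerSeries S →* _) f) (g := Units.map (φ : PowerSeries S →* _) g)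
        (a := φ a) (b := φ b) (by simp [ha]) (by simp [hb])
      change map φ (m • symbol f g) = 0
      rw [map_nsmul, map_symbol]
      rcases hm with rfl | ⟨hu, rfl⟩
      · exact key.1
      · rw [one_nsmul]; exact key.2 (unit _ hu)
    exact hle hx

end Application

end MilnorK

theorem mainTheorem3 (S : Type*) [CommRing S] (h2 : IsUnit (2 : S)) (hS : IsWeaklyStable 5 S) :
    (∀ p : ℕ, ∀ x ∈ MilnorK.V S p, p ^ (p - 1) • x ∈ MilnorK.W S p) ∧
    (∀ p : ℕ, 1 ≤ p → IsUnit (p : S) → MilnorK.V S p = MilnorK.W S p) ∧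
    (∀ (p i j : ℕ) (a b : S), p ≤ i + j →
      ∀ u v : (MilnorK.Trunc S p)ˣ,
        (u : MilnorK.Trunc S p) =
          1 + algebraMap S (MilnorK.Trunc S p) a * MilnorK.tbar S p ^ i →
        (v : MilnorK.Trunc S p) =
          1 + algebraMap S (MilnorK.Trunc S p) b * MilnorK.tbar S p ^ j →
        p ^ (p - 1) • MilnorK.symbol u v = 0 ∧
        (1 ≤ p → IsUnit (p : S) → MilnorK.symbol u v = 0)) := by
  refine ⟨fun p x hx => MilnorK.nsmul_mem_W_of_mem_V h2 hS (Or.inl rfl) hx,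
    fun p _ hu => le_antisymm (fun x hx => ?_) (MilnorK.W_le_V p), ?_⟩
  · simpa using MilnorK.nsmul_mem_W_of_mem_V h2 hS (Or.inr ⟨hu, rfl⟩) hx
  · intro p i j a b hij u v hu hv
    have h2' : IsUnit (2 : MilnorK.Trunc S p) := by
      have h := h2.map (algebraMap S (MilnorK.Trunc S p))
      rwa [map_ofNat] at h
    have key := MilnorK.pow_nsmul_symbol_eq_zero (MilnorK.isWeaklyStable_trunc hS p) h2'
      (MilnorK.tbar_pow_self S p) hij (hu.trans (by rw [mul_comm])) (hv.trans (by rw [mul_comm]))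
    exact ⟨key.1, fun _ hp => key.2 (by simpa using hp.map (algebraMap S (MilnorK.Trunc S p)))⟩
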